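/- **Theorem 1.6** (Wonenburger). Let $\mathbb{F}$ be a field of characteristic different from $2$, let $V$ be a finite-dimensional vector space over $\mathbb{F}$, and let $b : V \times V \to \mathbb{F}$ be a non-degenerate symmetric bilinear form. Let $\mathrm{O}(b)$ be the group of all $u \in \mathrm{GL}(V)$ such that $b(u(x),u(y)) = b(x,y)$ for all $x, y \in V$. Then every $u \in \mathrm{O}(b)$ is the product of two involutions of $\mathrm{O}(b)$, i.e. there exist $s_1, s_2 \in \mathrm{O}(b)$ such that $s_1^2 = s_2^2 = \mathrm{id}_V$ and $u = s_1 s_2$ (the identity counts as an involution). -/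

import Mathlib

/-- The group of isometries of a bilinear form `b` on `V`, as a subgroup of `GL(V)`: all linear
automorphisms `u` with `b (u x) (u y) = b x y`. When `b` is symmetric, this is the orthogonal
group `O(b)`. -/
def isomGroup {F V : Type*} [Field F] [AddCommGroup V] [Module F V]
    (b : LinearMap.BilinForm F V) : Subgroup (V ≃ₗ[F] V) where
  carrier := {u | ∀ x y : V, b (u x) (u y) = b x y}
  mul_mem' := by
    intro u v hu hv x y
    simp only [LinearEquiv.mul_apply]
    rw [hu, hv]
  one_mem' := by
    intro x y
    rfl
  inv_mem' := by
    intro u hu x y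
    have h := hu (u⁻¹ x) (u⁻¹ y)
    rw [← LinearEquiv.mul_apply, ← LinearEquiv.mul_apply, mul_inv_cancel] at h
    exact h.symm

/-- An involution of a group is an element whose square is the identity (so that the identity
itself is an involution). -/
def IsGroupInvolution {G : Type*} [Group G] (x : G) : Prop := x ^ 2 = 1

/-- An element of a group is bireflectional when it is the product of two involutions of that
group. -/
def IsBireflectional {G : Type*} [Group G] (g : G) : Prop :=
  ∃ s₁ s₂ : G, IsGroupInvolution s₁ ∧ IsGroupInvolution s₂ ∧ g = s₁ * s₂

/-! It suffices to find an isometric involution s with (su)² = 1, for then u = s · (su). This is an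
induction on the dimension: split off a nonzero `u`-stable nondegenerate W, reverse `u` on W, and
recurse on its orthogonal complement. If W is spanned by the orbits of x and y with b(uⁿx, x) =
b(uⁿy, y) for all n, exchanging uⁿx and u⁻ⁿy preserves the Gram matrix, so it defines such an s on W
(`exists_reversing_on_orbitSpan`).

To find x and y (`exists_disjoint_orthogonal_orbitSpan`), put τ = u + u⁻¹ and δ = u - u⁻¹. They
commute, τ is self-adjoint, δ is skew-adjoint and δ² = τ² - 4. Let the minimal polynomial of τ be
p^(j+1) q with p irreducible not dividing q. Usually x = y works: b((p^j q)(τ)x₀, x₀) ≠ 0 for some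
x₀, and x = q(τ)x₀ generates an orbit span which is the orthogonal sum of F[τ]x and F[τ]δx, both
nondegenerate. This can fail only if p = X - e with e = ±2 and (p^j q)(τ)δ ≠ 0. Then x and y are
chosen with totally isotropic orbit spans, in duality under b. -/

open Polynomial

/-! ### Gram matrices, orbit spans and the exchange map -/

section Gram

variable {F V : Type*} [Field F] [AddCommGroup V] [Module F V]

/-- A map between two families with the same Gram matrix extends to a linear map, provided that
the form is nondegenerate on the span of the target family. -/
theorem exists_linearMap_of_gram {ι : Type*} (b : LinearMap.BilinForm F V) (v w : ι → V)
    (hgram : ∀ i j, b (v i) (v j) = b (w i) (w j))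
    (hw : ∀ z ∈ Submodule.span F (Set.range w), (∀ i, b z (w i) = 0) → z = 0) :
    ∃ s : V →ₗ[F] V, ∀ i, s (v i) = w i := by
  have key : ∀ c : ι →₀ F, Finsupp.linearCombination F v c = 0 →
      Finsupp.linearCombination F w c = 0 := by
    intro c hc
    refine hw _ ?_ fun j => ?_
    · rw [← Finsupp.range_linearCombination]
      exact ⟨c, rfl⟩
    · have h : b (Finsupp.linearCombination F w c) (w j) =
          b (Finsupp.linearCombination F v c) (v j) := by
        simp [Finsupp.linearCombination_apply, Finsupp.sum, hgram]
      rw [h, hc]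
      simp
  -- `r` chooses coefficients over `v`; by `key` the choice does not affect the resulting
  -- combination of `w`.
  obtain ⟨r, hr⟩ := (Finsupp.linearCombination F v).rangeRestrict.exists_rightInverse_of_surjective
    (LinearMap.range_rangeRestrict _)
  obtain ⟨s, hs⟩ := LinearMap.exists_extend ((Finsupp.linearCombination F w).comp r)
  refine ⟨s, fun i => ?_⟩
  have hv : v i = Finsupp.linearCombination F v (Finsupp.single i 1) := by simp
  have hmem : v i ∈ LinearMap.range (Finsupp.linearCombination F v) := ⟨_, hv.symm⟩
  have h1 : s (v i) = Finsupp.linearCombination F w (r ⟨v i, hmem⟩) :=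
    LinearMap.congr_fun hs ⟨v i, hmem⟩
  have h2 : Finsupp.linearCombination F v (r ⟨v i, hmem⟩) = v i :=
    congrArg Subtype.val (LinearMap.congr_fun hr ⟨v i, hmem⟩)
  have h3 := key (r ⟨v i, hmem⟩ - Finsupp.single i 1) (by rw [map_sub, h2, ← hv, sub_self])
  rw [map_sub, sub_eq_zero] at h3
  rw [h1, h3]
  simp

theorem apply_inv_apply (u : V ≃ₗ[F] V) (x : V) : u (u⁻¹ x) = x :=
  LinearEquiv.congr_fun (mul_inv_cancel u) x

theorem inv_apply_apply (u : V ≃ₗ[F] V) (x : V) : u⁻¹ (u x) = x :=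
  LinearEquiv.congr_fun (inv_mul_cancel u) x

theorem inv_apply_mem_of_invariant [FiniteDimensional F V] {u : V ≃ₗ[F] V} {S : Submodule F V}
    (hS : ∀ z ∈ S, u z ∈ S) : ∀ z ∈ S, u⁻¹ z ∈ S := by
  have hmap : S.map (u : V →ₗ[F] V) = S :=
    Submodule.eq_of_le_of_finrank_eq (by rintro _ ⟨z, hz, rfl⟩; exact hS z hz)
      (LinearEquiv.finrank_map_eq u S)
  intro z hz
  rw [← hmap] at hz
  obtain ⟨t, ht, rfl⟩ := hz
  change (u⁻¹ * u) t ∈ S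
  rwa [inv_mul_cancel]

/-- The span of the orbit of `x` under the powers of `u`. -/
def orbitSpan (u : V ≃ₗ[F] V) (x : V) : Submodule F V :=
  Submodule.span F (Set.range fun n : ℤ => (u ^ n) x)

theorem orbitSpan_le {u : V ≃ₗ[F] V} {x : V} {S : Submodule F V} (hx : x ∈ S)
    (hu : ∀ z ∈ S, u z ∈ S) (hu' : ∀ z ∈ S, u⁻¹ z ∈ S) : orbitSpan u x ≤ S := by
  refine Submodule.span_le.2 ?_
  rintro _ ⟨n, rfl⟩
  change (u ^ n) x ∈ S
  induction n with
  | zero => simpa using hx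
  | succ n ih =>
    rw [add_comm, zpow_one_add]
    exact hu _ ih
  | pred n ih =>
    rw [show (-(n : ℤ) - 1) = -1 + -n by ring, zpow_add, zpow_neg_one]
    exact hu' _ ih

theorem zpow_mem_orbitSpan (u : V ≃ₗ[F] V) (x : V) (n : ℤ) : (u ^ n) x ∈ orbitSpan u x :=
  Submodule.subset_span ⟨n, rfl⟩

theorem self_mem_orbitSpan (u : V ≃ₗ[F] V) (x : V) : x ∈ orbitSpan u x :=
  zpow_mem_orbitSpan u x 0

theorem apply_mem_orbitSpan {u : V ≃ₗ[F] V} {x z : V} (hz : z ∈ orbitSpan u x) :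
    u z ∈ orbitSpan u x := by
  refine Submodule.span_induction (p := fun z _ => u z ∈ orbitSpan u x) ?_ ?_ ?_ ?_ hz
  · rintro _ ⟨n, rfl⟩
    have h := zpow_mem_orbitSpan u x (1 + n)
    rwa [zpow_one_add] at h
  · simp
  · intro y z _ _ hy hz
    rw [map_add]
    exact add_mem hy hz
  · intro a y _ hy
    rw [map_smul]
    exact Submodule.smul_mem _ _ hy

theorem inv_apply_mem_orbitSpan {u : V ≃ₗ[F] V} {x z : V} (hz : z ∈ orbitSpan u x) :
    u⁻¹ z ∈ orbitSpan u x := by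
  refine Submodule.span_induction (p := fun z _ => u⁻¹ z ∈ orbitSpan u x) ?_ ?_ ?_ ?_ hz
  · rintro _ ⟨n, rfl⟩
    have h := zpow_mem_orbitSpan u x (-1 + n)
    rwa [zpow_add, zpow_neg_one] at h
  · simp
  · intro y z _ _ hy hz
    rw [map_add]
    exact add_mem hy hz
  · intro a y _ hy
    rw [map_smul]
    exact Submodule.smul_mem _ _ hy

variable {b : LinearMap.BilinForm F V} {u : V ≃ₗ[F] V}

theorem isometry_adjoint (hu : u ∈ isomGroup b) (x y : V) : b (u x) y = b x (u⁻¹ y) := by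
  have h := hu x (u⁻¹ y)
  rwa [← LinearEquiv.mul_apply u u⁻¹ y, mul_inv_cancel] at h

theorem isometry_adjoint_inv (hu : u ∈ isomGroup b) (x y : V) : b (u⁻¹ x) y = b x (u y) := by
  simpa using isometry_adjoint (inv_mem hu) x y

theorem isometry_zpow_adjoint (hu : u ∈ isomGroup b) (n : ℤ) (x y : V) :
    b ((u ^ n) x) y = b x ((u ^ (-n)) y) := by
  rw [zpow_neg]
  exact isometry_adjoint (zpow_mem hu n) x y

theorem isometry_zpow_zpow (hu : u ∈ isomGroup b) (m n : ℤ) (x y : V) :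
    b ((u ^ m) x) ((u ^ n) y) = b ((u ^ (m - n)) x) y := by
  rw [isometry_zpow_adjoint hu m, isometry_zpow_adjoint hu (m - n), ← LinearEquiv.mul_apply,
    ← zpow_add]
  congr 3
  ring

/-- If `W` is nondegenerate and spanned by the orbits of `x` and `y`, whose Gram matrices agree,
then exchanging `u ^ n x` and `u ^ (-n) y` is an isometric involution of `W` that reverses `u`. -/
theorem exists_reversing_on_orbitSpan (hb : b.IsSymm) (hu : u ∈ isomGroup b) {x y : V}
    (hxy : ∀ n : ℤ, b ((u ^ n) x) x = b ((u ^ n) y) y)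
    (hW : Disjoint (orbitSpan u x ⊔ orbitSpan u y)
      (b.orthogonal (orbitSpan u x ⊔ orbitSpan u y))) :
    ∃ s : V →ₗ[F] V, ∀ z ∈ orbitSpan u x ⊔ orbitSpan u y,
      s z ∈ orbitSpan u x ⊔ orbitSpan u y ∧ s (s z) = z ∧ s (u (s (u z))) = z ∧
      ∀ w ∈ orbitSpan u x ⊔ orbitSpan u y, b (s z) (s w) = b z w := by
  set W := orbitSpan u x ⊔ orbitSpan u y
  let v : ℤ ⊕ ℤ → V := Sum.elim (fun n => (u ^ n) x) (fun n => (u ^ n) y)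
  -- The negated exponents make the exchange reverse `u`. They are harmless for the Gram matrix,
  -- since b(uⁱx, uʲx) depends only on i - j and, by symmetry, not on its sign.
  let w : ℤ ⊕ ℤ → V := Sum.elim (fun n => (u ^ (-n)) y) (fun n => (u ^ (-n)) x)
  have hneg (x : V) : Set.range (fun n : ℤ => (u ^ (-n)) x) = Set.range fun n : ℤ => (u ^ n) x :=
    (Equiv.neg ℤ).surjective.range_comp fun n : ℤ => (u ^ n) x
  have hv : Submodule.span F (Set.range v) = W := by
    rw [Set.Sum.elim_range, Submodule.span_union]
    rfl
  have hw : Submodule.span F (Set.range w) = W := by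
    rw [Set.Sum.elim_range, Submodule.span_union, hneg, hneg, sup_comm]
    rfl
  have hgram : ∀ i j, b (v i) (v j) = b (w i) (w j) := by
    rintro (i | i) (j | j) <;> simp only [v, w, Sum.elim_inl, Sum.elim_inr]
    · rw [hb.eq (_ : V), isometry_zpow_zpow hu, isometry_zpow_zpow hu, hxy]
      congr 4
      ring
    · rw [hb.eq, isometry_zpow_zpow hu, isometry_zpow_zpow hu]
      congr 4
      ring
    · rw [hb.eq, isometry_zpow_zpow hu, isometry_zpow_zpow hu]
      congr 4
      ring
    · rw [hb.eq (_ : V), isometry_zpow_zpow hu, isometry_zpow_zpow hu, hxy]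
      congr 4
      ring
  obtain ⟨s, hs⟩ := exists_linearMap_of_gram b v w hgram (by
    intro z hz h
    rw [hw] at hz
    refine Submodule.disjoint_def.1 hW z hz fun t ht => ?_
    rw [hb.eq]
    rw [← hw] at ht
    refine Submodule.span_induction (p := fun t _ => b z t = 0) ?_ (by simp) ?_ ?_ ht
    · rintro _ ⟨i, rfl⟩
      exact h i
    · intro p q _ _ hp hq
      rw [map_add, hp, hq, add_zero]
    · intro a p _ hp
      rw [map_smul, hp, smul_zero])
  have hx (n : ℤ) : s ((u ^ n) x) = (u ^ (-n)) y := hs (Sum.inl n)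
  have hy (n : ℤ) : s ((u ^ n) y) = (u ^ (-n)) x := hs (Sum.inr n)
  have hu1 (n : ℤ) (z : V) : u ((u ^ n) z) = (u ^ (1 + n)) z := by rw [zpow_one_add]; rfl
  have hsW : ∀ z ∈ W, s z ∈ W ∧ s (s z) = z ∧ s (u (s (u z))) = z := by
    intro z hz
    rw [← hv] at hz
    refine Submodule.span_induction
      (p := fun z _ => s z ∈ W ∧ s (s z) = z ∧ s (u (s (u z))) = z) ?_ (by simp) ?_ ?_ hz
    · rintro _ ⟨n | n, rfl⟩ <;> simp only [v, Sum.elim_inl, Sum.elim_inr]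
      · refine ⟨?_, by rw [hx, hy, neg_neg], ?_⟩
        · rw [hx]
          exact Submodule.mem_sup_right (zpow_mem_orbitSpan u y _)
        · rw [hu1, hx, hu1, hy]
          congr 2
          ring
      · refine ⟨?_, by rw [hy, hx, neg_neg], ?_⟩
        · rw [hy]
          exact Submodule.mem_sup_left (zpow_mem_orbitSpan u x _)
        · rw [hu1, hy, hu1, hx]
          congr 2
          ring
    · rintro p q _ _ ⟨h1, h2, h3⟩ ⟨h1', h2', h3'⟩
      simp only [map_add]
      exact ⟨add_mem h1 h1', by rw [h2, h2'], by rw [h3, h3']⟩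
    · rintro a p _ ⟨h1, h2, h3⟩
      simp only [map_smul]
      exact ⟨Submodule.smul_mem _ _ h1, by rw [h2], by rw [h3]⟩
  refine ⟨s, fun z hz => ⟨(hsW z hz).1, (hsW z hz).2.1, (hsW z hz).2.2, fun t ht => ?_⟩⟩
  rw [← hv] at hz ht
  refine Submodule.span_induction₂ (p := fun z t _ _ => b (s z) (s t) = b z t)
    ?_ ?_ ?_ ?_ ?_ ?_ ?_ hz ht
  · rintro _ _ ⟨i, rfl⟩ ⟨j, rfl⟩
    rw [hs, hs, hgram]
  · simp
  · simp
  · intro p q r _ _ _ h h'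
    simp [h, h']
  · intro p q r _ _ _ h h'
    simp [h, h']
  · intro a p q _ _ h
    simp [h]
  · intro a p q _ _ h
    simp [h]

end Gram

/-! ### Primary cyclic modules, and the algebra of u + u⁻¹ and u - u⁻¹ -/

section Operators

variable {F V : Type*} [Field F] [AddCommGroup V] [Module F V]

theorem aeval_apply_mem {T : Module.End F V} {S : Submodule F V} (hT : ∀ z ∈ S, T z ∈ S)
    (f : F[X]) {z : V} (hz : z ∈ S) : aeval T f z ∈ S := by
  induction f using Polynomial.induction_on' with
  | add f g hf hg =>
    rw [map_add]
    exact add_mem hf hg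
  | monomial n a =>
    rw [aeval_monomial, Module.End.mul_apply, Module.algebraMap_end_apply]
    refine Submodule.smul_mem _ _ ?_
    induction n with
    | zero => simpa using hz
    | succ n ih =>
      rw [pow_succ', Module.End.mul_apply]
      exact hT _ ih

theorem aeval_mul_apply (T : Module.End F V) (f g : F[X]) (x : V) :
    aeval T (f * g) x = aeval T f (aeval T g x) := by
  rw [map_mul, Module.End.mul_apply]

theorem aeval_mul_apply_eq_zero {T : Module.End F V} {f : F[X]} {x : V}
    (hf : aeval T f x = 0) (g : F[X]) : aeval T (f * g) x = 0 := by
  rw [mul_comm, aeval_mul_apply, hf, map_zero]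

/-- If a functional does not vanish on the socle of the cyclic module generated by a vector of
primary order, then its restriction to that module has no nonzero submodule in its kernel. -/
theorem aeval_apply_eq_zero_of_functional {T : Module.End F V} {p : F[X]} (hp : Irreducible p)
    {j : ℕ} {x : V} (hx : aeval T (p ^ (j + 1)) x = 0) (φ : V →ₗ[F] F) {g : F[X]}
    (hg : φ (aeval T (p ^ j * g) x) ≠ 0) {f : F[X]} (hf : ∀ h, φ (aeval T (f * h) x) = 0) :
    aeval T f x = 0 := by
  by_cases hdvd : p ^ (j + 1) ∣ f
  · obtain ⟨r, rfl⟩ := hdvd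
    exact aeval_mul_apply_eq_zero hx r
  have hf0 : f ≠ 0 := fun h => hdvd (h ▸ dvd_zero _)
  obtain ⟨r, hfr, hr⟩ :=
    (FiniteMultiplicity.of_not_isUnit hp.not_isUnit hf0).exists_eq_pow_mul_and_not_dvd
  generalize multiplicity p f = i at hfr
  subst hfr
  have hij : i ≤ j := by
    by_contra! h
    exact hdvd ((pow_dvd_pow p h).mul_right r)
  obtain ⟨a, c, hac⟩ := (hp.coprime_iff_not_dvd.2 hr).symm
  obtain ⟨l, rfl⟩ := Nat.exists_eq_add_of_le hij
  -- As r is invertible modulo p, p^j g lies in the ideal generated by f and p^(j+1), so vanishing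
  -- on all multiples of f would contradict `hg`.
  have heq : p ^ (i + l) * g = p ^ i * r * (a * p ^ l * g) + p ^ (i + l + 1) * (c * g) := by
    linear_combination (-p ^ (i + l) * g) * hac
  rw [heq, map_add, LinearMap.add_apply, aeval_mul_apply_eq_zero hx, add_zero] at hg
  exact absurd (hf _) hg

/-- A factor coprime to p acts invertibly on the socle, so `g` can absorb its inverse modulo p. -/
theorem exists_functional_ne_zero_of_isCoprime {T : Module.End F V} {p : F[X]} {j : ℕ} {x : V}
    (hx : aeval T (p ^ (j + 1)) x = 0) (φ : V →ₗ[F] F) {g : F[X]}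
    (hg : φ (aeval T (p ^ j * g) x) ≠ 0) {h : F[X]} (hh : IsCoprime h p) :
    ∃ g', φ (aeval T (p ^ j * g' * h) x) ≠ 0 := by
  obtain ⟨a, c, hac⟩ := hh
  refine ⟨g * a, ?_⟩
  have heq : p ^ j * g = p ^ j * (g * a) * h + p ^ (j + 1) * (g * c) := by
    linear_combination (-p ^ j * g) * hac
  rwa [heq, map_add, LinearMap.add_apply, aeval_mul_apply_eq_zero hx, add_zero] at hg

theorem exists_aeval_apply_eq_of_mem_orbitSpan [FiniteDimensional F V] {u : V ≃ₗ[F] V} {x z : V}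
    (hz : z ∈ orbitSpan u x) : ∃ f : F[X], z = aeval (u : Module.End F V) f x := by
  let S : Submodule F V :=
    LinearMap.range (LinearMap.applyₗ x ∘ₗ (aeval (u : Module.End F V)).toLinearMap)
  have hS : ∀ z ∈ S, u z ∈ S := by
    rintro _ ⟨f, rfl⟩
    refine ⟨X * f, ?_⟩
    simp
  have h : orbitSpan u x ≤ S :=
    orbitSpan_le ⟨1, by simp⟩ hS (inv_apply_mem_of_invariant hS)
  obtain ⟨f, hf⟩ := h hz
  exact ⟨f, hf.symm⟩

/-- The operator `u + u⁻¹`, which is self-adjoint when `u` is an isometry. -/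
def traceOp (u : V ≃ₗ[F] V) : Module.End F V := (u : V →ₗ[F] V) + (u⁻¹ : V ≃ₗ[F] V)

/-- The operator `u - u⁻¹`, which is skew-adjoint when `u` is an isometry. -/
def skewOp (u : V ≃ₗ[F] V) : Module.End F V := (u : V →ₗ[F] V) - (u⁻¹ : V ≃ₗ[F] V)

theorem traceOp_apply (u : V ≃ₗ[F] V) (x : V) : traceOp u x = u x + u⁻¹ x := rfl

theorem skewOp_apply (u : V ≃ₗ[F] V) (x : V) : skewOp u x = u x - u⁻¹ x := rfl

theorem skewOp_skewOp_apply (u : V ≃ₗ[F] V) (x : V) :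
    skewOp u (skewOp u x) = aeval (traceOp u) (X ^ 2 - 4 : F[X]) x := by
  have h : aeval (traceOp u) (X ^ 2 - 4 : F[X]) x =
      traceOp u (traceOp u x) - (4 : F) • x := by
    rw [show (4 : F[X]) = C 4 from rfl]
    simp only [map_sub, aeval_C, pow_two, map_mul, aeval_X, LinearMap.sub_apply,
      Module.End.mul_apply, Module.algebraMap_end_apply]
  rw [h]
  simp only [skewOp_apply, traceOp_apply, map_add, map_sub, apply_inv_apply, inv_apply_apply]
  module

theorem aeval_apply_of_commute {T S : Module.End F V} (hc : ∀ x, T (S x) = S (T x)) (f : F[X])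
    (x : V) : aeval T f (S x) = S (aeval T f x) := by
  have h : Commute (aeval T f) S := by
    induction f using Polynomial.induction_on' with
    | add f g hf hg =>
      rw [map_add]
      exact hf.add_left hg
    | monomial n a =>
      rw [aeval_monomial]
      exact (Algebra.commute_algebraMap_left a _).mul_left
        (Commute.pow_left (LinearMap.ext hc : T * S = S * T) n)
  exact LinearMap.congr_fun h.eq x

theorem aeval_traceOp_skewOp_apply (u : V ≃ₗ[F] V) (f : F[X]) (x : V) :
    aeval (traceOp u) f (skewOp u x) = skewOp u (aeval (traceOp u) f x) := by
  refine aeval_apply_of_commute (fun x => ?_) f x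
  simp only [traceOp_apply, skewOp_apply, map_add, map_sub, apply_inv_apply, inv_apply_apply]
  module

/-- Since δ² = τ² - 4, the sum F[τ]x + F[τ]δx is stable under τ and δ, hence under u = (τ + δ)/2 and
u⁻¹ = (τ - δ)/2. -/
theorem exists_aeval_add_aeval_of_mem_orbitSpan (h2 : (2 : F) ≠ 0) {u : V ≃ₗ[F] V} {x z : V}
    (hz : z ∈ orbitSpan u x) :
    ∃ f g : F[X], z = aeval (traceOp u) f x + aeval (traceOp u) g (skewOp u x) := by
  let A (y : V) : F[X] →ₗ[F] V := LinearMap.applyₗ y ∘ₗ (aeval (traceOp u)).toLinearMap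
  have hA (y : V) (f : F[X]) : A y f = aeval (traceOp u) f y := rfl
  let S : Submodule F V := LinearMap.range (A x) ⊔ LinearMap.range (A (skewOp u x))
  have hτ : ∀ z ∈ S, traceOp u z ∈ S := by
    intro z hz
    obtain ⟨_, ⟨f, rfl⟩, _, ⟨g, rfl⟩, rfl⟩ := Submodule.mem_sup.1 hz
    rw [map_add]
    refine Submodule.add_mem_sup ⟨X * f, ?_⟩ ⟨X * g, ?_⟩ <;> simp [hA]
  have hδ : ∀ z ∈ S, skewOp u z ∈ S := by
    intro z hz
    obtain ⟨_, ⟨f, rfl⟩, _, ⟨g, rfl⟩, rfl⟩ := Submodule.mem_sup.1 hz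
    rw [map_add, add_comm]
    refine Submodule.add_mem_sup ⟨g * (X ^ 2 - 4), ?_⟩ ⟨f, ?_⟩
    · rw [hA, hA, aeval_mul_apply, ← skewOp_skewOp_apply, aeval_traceOp_skewOp_apply]
    · rw [hA, hA, aeval_traceOp_skewOp_apply]
  have hu (z : V) : u z = (2⁻¹ : F) • (traceOp u z + skewOp u z) := by
    rw [eq_inv_smul_iff₀ h2, traceOp_apply, skewOp_apply]
    module
  have hu' (z : V) : u⁻¹ z = (2⁻¹ : F) • (traceOp u z - skewOp u z) := by
    rw [eq_inv_smul_iff₀ h2, traceOp_apply, skewOp_apply]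
    module
  have h : orbitSpan u x ≤ S := by
    refine orbitSpan_le (Submodule.mem_sup_left ⟨1, by simp [hA]⟩) (fun z hz => ?_) fun z hz => ?_
    · rw [hu]
      exact Submodule.smul_mem _ _ (add_mem (hτ z hz) (hδ z hz))
    · rw [hu']
      exact Submodule.smul_mem _ _ (sub_mem (hτ z hz) (hδ z hz))
  obtain ⟨_, ⟨f, rfl⟩, _, ⟨g, rfl⟩, rfl⟩ := Submodule.mem_sup.1 (h hz)
  exact ⟨f, g, rfl⟩

theorem skewOp_mem_orbitSpan {u : V ≃ₗ[F] V} {x z : V} (hz : z ∈ orbitSpan u x) :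
    skewOp u z ∈ orbitSpan u x :=
  sub_mem (apply_mem_orbitSpan hz) (inv_apply_mem_orbitSpan hz)

theorem aeval_traceOp_mem_orbitSpan {u : V ≃ₗ[F] V} {x z : V} (f : F[X])
    (hz : z ∈ orbitSpan u x) : aeval (traceOp u) f z ∈ orbitSpan u x :=
  aeval_apply_mem (fun _ h => add_mem (apply_mem_orbitSpan h) (inv_apply_mem_orbitSpan h)) f hz

end Operators

/-! ### Adjoints, and nondegeneracy of a single orbit span -/

section Isometries

variable {F V : Type*} [Field F] [AddCommGroup V] [Module F V]
  {b : LinearMap.BilinForm F V} {u : V ≃ₗ[F] V}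

theorem aeval_traceOp_adjoint (hu : u ∈ isomGroup b) (f : F[X]) (x y : V) :
    b (aeval (traceOp u) f x) y = b x (aeval (traceOp u) f y) := by
  have hτ (x y : V) : b (traceOp u x) y = b x (traceOp u y) := by
    simp only [traceOp_apply, map_add, LinearMap.add_apply, isometry_adjoint hu,
      isometry_adjoint_inv hu]
    exact add_comm _ _
  induction f using Polynomial.induction_on' generalizing x y with
  | add f g hf hg => simp [hf, hg]
  | monomial n a =>
    simp only [aeval_monomial, Module.End.mul_apply, Module.algebraMap_end_apply, map_smul,
      LinearMap.smul_apply]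
    congr 1
    induction n generalizing x y with
    | zero => simp
    | succ n ih =>
      rw [pow_succ', Module.End.mul_apply, hτ, ih, ← Module.End.mul_apply, ← pow_succ, pow_succ']

theorem skewOp_adjoint (hu : u ∈ isomGroup b) (x y : V) :
    b (skewOp u x) y = -b x (skewOp u y) := by
  simp only [skewOp_apply, map_sub, LinearMap.sub_apply, isometry_adjoint hu,
    isometry_adjoint_inv hu]
  ring

/-- The operator f(τ)δ is skew-adjoint, so its quadratic form equals its own negative. Consequently
F[τ]x and F[τ]δx are orthogonal. -/
theorem aeval_traceOp_skewOp_self (h2 : (2 : F) ≠ 0) (hb : b.IsSymm) (hu : u ∈ isomGroup b)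
    (f : F[X]) (x : V) : b (aeval (traceOp u) f (skewOp u x)) x = 0 := by
  have h : b (aeval (traceOp u) f (skewOp u x)) x = -b (aeval (traceOp u) f (skewOp u x)) x := by
    conv_lhs => rw [aeval_traceOp_adjoint hu, skewOp_adjoint hu, ← aeval_traceOp_skewOp_apply,
      hb.eq]
  have h' : 2 * b (aeval (traceOp u) f (skewOp u x)) x = 0 := by linear_combination h
  exact (mul_eq_zero.1 h').resolve_left h2

theorem aeval_traceOp_skewOp_skewOp (hu : u ∈ isomGroup b) (f : F[X]) (x y : V) :
    b (aeval (traceOp u) f (skewOp u x)) (skewOp u y) =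
      -b (aeval (traceOp u) (f * (X ^ 2 - 4)) x) y := by
  rw [aeval_mul_apply, ← skewOp_skewOp_apply, aeval_traceOp_skewOp_apply, aeval_traceOp_skewOp_apply,
    aeval_traceOp_skewOp_apply, skewOp_adjoint hu (skewOp u _), neg_neg]

/-- Because F[τ]x and F[τ]δx are orthogonal, nondegeneracy can be tested on each of them separately;
`hx` and `hx'` are these two tests. -/
theorem disjoint_orthogonal_orbitSpan (h2 : (2 : F) ≠ 0) (hb : b.IsSymm) (hu : u ∈ isomGroup b)
    {x : V}
    (hx : ∀ f : F[X], (∀ h, b (aeval (traceOp u) (f * h) x) x = 0) → aeval (traceOp u) f x = 0)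
    (hx' : ∀ f : F[X], (∀ h, b (aeval (traceOp u) (f * h) (skewOp u x)) (skewOp u x) = 0) →
      aeval (traceOp u) f (skewOp u x) = 0) :
    Disjoint (orbitSpan u x) (b.orthogonal (orbitSpan u x)) := by
  refine Submodule.disjoint_def.2 fun z hz hz' => ?_
  have horth : ∀ w ∈ orbitSpan u x, b z w = 0 := fun w hw => (hb.eq _ _).trans (hz' w hw)
  obtain ⟨f, g, rfl⟩ := exists_aeval_add_aeval_of_mem_orbitSpan h2 hz
  have hself := self_mem_orbitSpan u x
  rw [hx f fun h => ?_, hx' g fun h => ?_, add_zero]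
  · have := horth _ (aeval_traceOp_mem_orbitSpan h (skewOp_mem_orbitSpan hself))
    rw [← aeval_traceOp_adjoint hu, map_add, ← aeval_mul_apply, ← aeval_mul_apply, map_add,
      LinearMap.add_apply, hb.eq (aeval (traceOp u) _ x), ← aeval_traceOp_adjoint hu,
      aeval_traceOp_skewOp_self h2 hb hu, zero_add] at this
    rwa [mul_comm]
  · have := horth _ (aeval_traceOp_mem_orbitSpan h hself)
    rw [← aeval_traceOp_adjoint hu, map_add, ← aeval_mul_apply, ← aeval_mul_apply, map_add,
      LinearMap.add_apply, aeval_traceOp_skewOp_self h2 hb hu, add_zero] at this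
    rwa [mul_comm]

/-- Polarization: if b(Ax, x) vanished identically, so would 2b(Ax, y). -/
theorem exists_apply_self_ne_zero (h2 : (2 : F) ≠ 0) (hb : b.IsSymm) (hnd : b.Nondegenerate)
    {A : Module.End F V} (hA : ∀ x y, b (A x) y = b x (A y)) (hA0 : A ≠ 0) :
    ∃ x, b (A x) x ≠ 0 := by
  by_contra! h
  refine hA0 (LinearMap.ext fun x => hnd.1 _ fun y => ?_)
  have h1 := h (x + y)
  simp only [map_add, LinearMap.add_apply, h, zero_add, add_zero] at h1
  rw [hA y x, hb.eq y, ← two_mul] at h1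
  exact (mul_eq_zero.1 h1).resolve_left h2

/-! ### The exceptional eigenvalues e = ±2 of u + u⁻¹ -/

variable {e : F}

theorem sq_sub_four_eq (he : e ^ 2 = 4) : (X ^ 2 - 4 : F[X]) = (X - C e) * (X + C e) := by
  have h : (C e : F[X]) ^ 2 = 4 := by rw [← C_pow, he]; rfl
  linear_combination h

/-- One can correct `x` by a multiple of the orbit of `y` so as to make its orbit isotropic. -/
theorem exists_isotropic (h2 : (2 : F) ≠ 0) (hb : b.IsSymm) (hu : u ∈ isomGroup b)
    (he : e ^ 2 = 4) {j : ℕ} {x y : V} (hx : aeval (traceOp u) ((X - C e) ^ (j + 1)) x = 0)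
    (hy : aeval (traceOp u) ((X - C e) ^ (j + 1)) y = 0)
    (hxy : b (aeval (traceOp u) ((X - C e) ^ j) (skewOp u x)) y ≠ 0) :
    ∃ x', aeval (traceOp u) ((X - C e) ^ (j + 1)) x' = 0 ∧
      b (aeval (traceOp u) ((X - C e) ^ j) (skewOp u x')) y ≠ 0 ∧
      ∀ f : F[X], b (aeval (traceOp u) f x') x' = 0 := by
  have hvan {v : V} (hv : aeval (traceOp u) ((X - C e) ^ (j + 1)) v = 0) {i : ℕ} (hi : j + 1 ≤ i)
      (g : F[X]) : aeval (traceOp u) ((X - C e) ^ i * g) v = 0 := by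
    obtain ⟨l, rfl⟩ := Nat.exists_eq_add_of_le hi
    rw [pow_add, mul_assoc]
    exact aeval_mul_apply_eq_zero hv _
  -- The values b((τ - e)ⁱx', x') are killed by descending i, one per step, by adding a multiple of
  -- (τ - e)ˡδy.
  have step : ∀ l ≤ j + 1, ∃ x', aeval (traceOp u) ((X - C e) ^ (j + 1)) x' = 0 ∧
      b (aeval (traceOp u) ((X - C e) ^ j) (skewOp u x')) y ≠ 0 ∧
      ∀ i, j + 1 ≤ i + l → b (aeval (traceOp u) ((X - C e) ^ i) x') x' = 0 := by
    intro l
    induction l with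
    | zero =>
      refine fun _ => ⟨x, hx, hxy, fun i hi => ?_⟩
      have := hvan hx hi 1
      rw [mul_one, add_zero] at this
      rw [this, map_zero, LinearMap.zero_apply]
    | succ l ih =>
      intro hl
      obtain ⟨z, hz, hzy, hzi⟩ := ih (by omega)
      have hδy {i : ℕ} (hi : j + 1 ≤ i) :
          aeval (traceOp u) ((X - C e) ^ i) (skewOp u y) = 0 := by
        have := hvan hy hi 1
        rw [mul_one] at this
        rw [aeval_traceOp_skewOp_apply, this, map_zero]
      have hδδ {i : ℕ} (hi : j ≤ i) :
          aeval (traceOp u) ((X - C e) ^ i) (skewOp u (skewOp u y)) = 0 := by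
        rw [skewOp_skewOp_apply, ← aeval_mul_apply, sq_sub_four_eq he, ← mul_assoc, ← pow_succ]
        exact hvan hy (by omega) _
      have hyz : b (aeval (traceOp u) ((X - C e) ^ j) (skewOp u y)) z ≠ 0 := by
        rwa [aeval_traceOp_adjoint hu, skewOp_adjoint hu, ← aeval_traceOp_skewOp_apply, hb.eq,
          neg_ne_zero]
      obtain ⟨i₀, hi₀⟩ := Nat.exists_eq_add_of_le (Nat.le_of_succ_le_succ hl)
      set β := b (aeval (traceOp u) ((X - C e) ^ j) (skewOp u y)) z with hβ
      -- At i = i₀ = j - l the corrected value is b((τ - e)ⁱz, z) + 2aβ; this `a` makes it zero.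
      set a := -b (aeval (traceOp u) ((X - C e) ^ i₀) z) z / (2 * β) with ha
      set t := aeval (traceOp u) ((X - C e) ^ l) (skewOp u y) with ht
      have hpt (i : ℕ) : aeval (traceOp u) ((X - C e) ^ i) t =
          aeval (traceOp u) ((X - C e) ^ (i + l)) (skewOp u y) := by
        rw [ht, ← aeval_mul_apply, pow_add]
      refine ⟨z + a • t, ?_, ?_, fun i hi => ?_⟩
      · rw [map_add, map_smul, hz, hpt, hδy (by omega), smul_zero, add_zero]
      · have h0 : aeval (traceOp u) ((X - C e) ^ j) (skewOp u t) = 0 := by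
          rw [ht, ← aeval_traceOp_skewOp_apply, ← aeval_mul_apply, ← pow_add]
          exact hδδ (by omega)
        rw [map_add, map_add, map_smul, map_smul, h0, smul_zero, add_zero]
        exact hzy
      -- No term in a² survives: the two factors δ produce an extra τ - e, which raises the exponent
      -- to at least j + 1.
      · have htt : b (aeval (traceOp u) ((X - C e) ^ i) t) t = 0 := by
          rw [ht, ← aeval_traceOp_adjoint hu, ← aeval_mul_apply, ← aeval_mul_apply, ← pow_add,
            ← pow_add, aeval_traceOp_skewOp_skewOp hu, sq_sub_four_eq he, ← mul_assoc, ← pow_succ,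
            hvan hy (by omega)]
          simp
        have hzt : b (aeval (traceOp u) ((X - C e) ^ i) z) t =
            b (aeval (traceOp u) ((X - C e) ^ i) t) z := by
          rw [aeval_traceOp_adjoint hu, hb.eq]
        have hexp : b (aeval (traceOp u) ((X - C e) ^ i) (z + a • t)) (z + a • t) =
            b (aeval (traceOp u) ((X - C e) ^ i) z) z +
              2 * a * b (aeval (traceOp u) ((X - C e) ^ i) t) z := by
          simp only [map_add, map_smul, LinearMap.add_apply, LinearMap.smul_apply, smul_eq_mul,
            htt, hzt]
          ring
        rw [hexp, hpt]
        rcases (show j + 1 ≤ i + l ∨ i + l = j by omega) with h | h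
        · rw [hzi i h, hδy h]
          simp
        · obtain rfl : i = i₀ := by omega
          rw [h, ← hβ, ha]
          field_simp
          ring
  obtain ⟨x', hx', hxy', h⟩ := step (j + 1) le_rfl
  refine ⟨x', hx', hxy', fun f => ?_⟩
  have hpow (i : ℕ) : b (aeval (traceOp u) ((X - C e) ^ i) x') x' = 0 := h i (by omega)
  -- Taylor expansion at e reduces to powers of X - e.
  have hf : f = (f.comp (X + C e)).comp (X - C e) := by
    rw [comp_assoc]
    simp
  rw [hf]
  induction f.comp (X + C e) using Polynomial.induction_on' with
  | add f g hf hg => simp only [add_comp, map_add, LinearMap.add_apply, hf, hg, add_zero]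
  | monomial n a =>
    rw [monomial_comp, aeval_mul_apply, aeval_C, Module.algebraMap_end_apply, map_smul,
      LinearMap.smul_apply, hpow, smul_zero]

theorem aeval_skewOp_swap (hb : b.IsSymm) (hu : u ∈ isomGroup b) (f : F[X]) (x y : V) :
    b (aeval (traceOp u) f (skewOp u x)) y = -b (aeval (traceOp u) f (skewOp u y)) x := by
  rw [aeval_traceOp_adjoint hu, skewOp_adjoint hu, ← aeval_traceOp_skewOp_apply, hb.eq]

/-- With e = 2ε and ε = ±1, one has (u - ε)² = u(τ - e) and (u - ε)(u + ε) = uδ. Thus x is killed by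
(u - ε)^(2j+2), and `hxy` says that pairing with a vector of the orbit of y is nonzero on the socle
of F[u]x. -/
theorem eq_zero_of_mem_orbitSpan_of_forall_mem [FiniteDimensional F V] (h2 : (2 : F) ≠ 0)
    (hb : b.IsSymm) (hu : u ∈ isomGroup b) (he : e ^ 2 = 4) {j : ℕ} {x y : V}
    (hx : aeval (traceOp u) ((X - C e) ^ (j + 1)) x = 0)
    (hxy : b (aeval (traceOp u) ((X - C e) ^ j) (skewOp u x)) y ≠ 0) {z : V}
    (hz : z ∈ orbitSpan u x) (hzy : ∀ w ∈ orbitSpan u y, b z w = 0) : z = 0 := by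
  obtain ⟨ε, rfl⟩ : ∃ ε, e = 2 * ε := ⟨e / 2, by field_simp⟩
  have hε : ε ^ 2 = 1 := by
    have h4 : (2 : F) * 2 ≠ 0 := mul_ne_zero h2 h2
    refine mul_left_cancel₀ h4 ?_
    linear_combination he
  obtain ⟨f, rfl⟩ := exists_aeval_apply_eq_of_mem_orbitSpan hz
  set U : Module.End F V := (u : V →ₗ[F] V)
  have hUa (v : V) : U v = u v := rfl
  have hsq (v : V) : aeval U ((X - C ε) ^ 2) v = U (aeval (traceOp u) (X - C (2 * ε)) v) := by
    simp only [pow_two, map_sub, aeval_C, aeval_X, map_mul (aeval U), LinearMap.sub_apply,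
      Module.End.mul_apply, Module.algebraMap_end_apply, map_smul, traceOp_apply, hUa, map_add,
      apply_inv_apply]
    rw [smul_sub, smul_smul, ← pow_two, hε]
    module
  have hsq' (v : V) : aeval U ((X - C ε) * (X + C ε)) v = U (skewOp u v) := by
    simp only [map_sub, aeval_C, aeval_X, map_mul, LinearMap.sub_apply, LinearMap.add_apply,
      Module.End.mul_apply, Module.algebraMap_end_apply, map_smul, skewOp_apply, hUa, map_add,
      apply_inv_apply]
    rw [smul_sub, smul_smul, ← pow_two, hε]
    module
  have hcomm (g : F[X]) (v : V) : aeval (traceOp u) g (U v) = U (aeval (traceOp u) g v) := by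
    refine aeval_apply_of_commute (fun v => ?_) g v
    simp only [hUa, traceOp_apply, map_add, apply_inv_apply, inv_apply_apply]
  have hpow (n : ℕ) (v : V) : aeval U ((X - C ε) ^ (2 * n)) v =
      (U ^ n) (aeval (traceOp u) ((X - C (2 * ε)) ^ n) v) := by
    induction n generalizing v with
    | zero => simp
    | succ n ih =>
      rw [mul_add, mul_one, pow_add, aeval_mul_apply, hsq, ih, hcomm, ← aeval_mul_apply,
        ← pow_succ, pow_succ U, Module.End.mul_apply]
  have hmem (n : ℕ) : (U ^ n) y ∈ orbitSpan u y := by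
    induction n with
    | zero => exact self_mem_orbitSpan u y
    | succ n ih =>
      rw [pow_succ', Module.End.mul_apply]
      exact apply_mem_orbitSpan ih
  have hiso (n : ℕ) (v w : V) : b ((U ^ n) v) ((U ^ n) w) = b v w := by
    induction n with
    | zero => rfl
    | succ n ih => rw [pow_succ', Module.End.mul_apply, Module.End.mul_apply, hUa, hUa, hu, ih]
  -- Here (u - ε)^(2j+1)(u + ε)x = u^(j+1)(τ - e)^j δx; pairing with u^(j+1)y cancels the power of
  -- `u`.
  refine aeval_apply_eq_zero_of_functional (irreducible_X_sub_C ε) (j := 2 * j + 1)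
    (g := X + C ε) ?_ (LinearMap.flip b ((U ^ (j + 1)) y)) ?_ fun h => ?_
  · rw [show 2 * j + 1 + 1 = 2 * (j + 1) by ring, hpow, hx, map_zero]
  · rw [pow_succ (X - C ε), mul_assoc, aeval_mul_apply, hsq', hpow, hcomm, ← Module.End.mul_apply,
      ← pow_succ, LinearMap.flip_apply, hiso]
    exact hxy
  · rw [mul_comm, aeval_mul_apply, LinearMap.flip_apply, hb.eq]
    refine aeval_apply_mem (S := b.orthogonal (orbitSpan u y)) (fun v hv w hw => ?_) h
      (fun w hw => (hb.eq _ _).trans (hzy w hw)) _ (hmem _)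
    have := hv _ (inv_apply_mem_orbitSpan hw)
    rwa [isometry_adjoint_inv hu] at this

/-! ### Existence of the two orbits -/

/-- An isometry of a nonzero nondegenerate symmetric space admits a nonzero invariant
nondegenerate subspace spanned by two orbits with the same Gram matrix. -/
theorem exists_disjoint_orthogonal_orbitSpan [FiniteDimensional F V] [Nontrivial V]
    (h2 : (2 : F) ≠ 0) (hb : b.IsSymm) (hnd : b.Nondegenerate) (hu : u ∈ isomGroup b) :
    ∃ x y : V, x ≠ 0 ∧ (∀ n : ℤ, b ((u ^ n) x) x = b ((u ^ n) y) y) ∧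
      Disjoint (orbitSpan u x ⊔ orbitSpan u y)
        (b.orthogonal (orbitSpan u x ⊔ orbitSpan u y)) := by
  have hμ0 : minpoly F (traceOp u) ≠ 0 := minpoly.ne_zero (Algebra.IsIntegral.isIntegral _)
  obtain ⟨p, hp, hpμ, hpe⟩ : ∃ p : F[X], Irreducible p ∧ p ∣ minpoly F (traceOp u) ∧
      (p ∣ X ^ 2 - 4 → ∃ e, e ^ 2 = 4 ∧ p = X - C e) := by
    -- Taking X - e itself whenever possible avoids working with an associate of it.
    by_cases h : ∃ e : F, e ^ 2 = 4 ∧ X - C e ∣ minpoly F (traceOp u)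
    · obtain ⟨e, he, hdvd⟩ := h
      exact ⟨X - C e, irreducible_X_sub_C e, hdvd, fun _ => ⟨e, he, rfl⟩⟩
    · obtain ⟨p, hp, hdvd⟩ :=
        WfDvdMonoid.exists_irreducible_factor (minpoly.not_isUnit F (traceOp u)) hμ0
      refine ⟨p, hp, hdvd, fun hp4 => absurd ?_ h⟩
      have h4 : (2 : F) ^ 2 = 4 := by norm_num
      have h4' : (-2 : F) ^ 2 = 4 := by norm_num
      rw [sq_sub_four_eq h4] at hp4
      rcases hp.prime.dvd_or_dvd hp4 with hp2 | hp2
      · exact ⟨2, h4, ((hp.associated_of_dvd (irreducible_X_sub_C _) hp2).symm.dvd).trans hdvd⟩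
      · rw [show (X + C 2 : F[X]) = X - C (-2) by simp] at hp2
        exact ⟨-2, h4', ((hp.associated_of_dvd (irreducible_X_sub_C _) hp2).symm.dvd).trans hdvd⟩
  have hfin := FiniteMultiplicity.of_not_isUnit hp.not_isUnit hμ0
  obtain ⟨q, hμq, hpq⟩ := hfin.exists_eq_pow_mul_and_not_dvd
  obtain ⟨j, hj⟩ := Nat.exists_eq_succ_of_ne_zero (multiplicity_ne_zero.2 hpμ)
  rw [hj, Nat.succ_eq_add_one] at hμq
  have hkill (v : V) : aeval (traceOp u) (p ^ (j + 1) * q) v = 0 := by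
    rw [← hμq, minpoly.aeval, LinearMap.zero_apply]
  have hkill' (v : V) : aeval (traceOp u) (p ^ (j + 1)) (aeval (traceOp u) q v) = 0 := by
    rw [← aeval_mul_apply, hkill]
  have hc0 : aeval (traceOp u) (p ^ j * q) ≠ 0 := by
    intro h
    have hdvd := minpoly.dvd F _ h
    rw [hμq] at hdvd
    have hq0 : q ≠ 0 := fun h => hpq (h ▸ dvd_zero _)
    have := (pow_dvd_pow_iff hp.ne_zero hp.not_isUnit).1 ((mul_dvd_mul_iff_right hq0).1 hdvd)
    omega
  obtain ⟨a, c, hac⟩ := (hp.coprime_iff_not_dvd.2 hpq).symm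
  -- Since aq ≡ 1 modulo p, vectors can be moved into the p-primary part, the image of q(τ), without
  -- changing their image under (p^j q)(τ).
  have hreduce (v : V) : aeval (traceOp u) (p ^ j * q * (a * q)) v =
      aeval (traceOp u) (p ^ j * q) v := by
    rw [show p ^ j * q * (a * q) = p ^ j * q - p ^ (j + 1) * q * c by
      linear_combination (p ^ j * q) * hac, map_sub, LinearMap.sub_apply,
      aeval_mul_apply_eq_zero (hkill v), sub_zero]
  by_cases hcase : p ∣ X ^ 2 - 4 ∧ ∃ v, aeval (traceOp u) (p ^ j * q) (skewOp u v) ≠ 0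
  · obtain ⟨hp4, v, hv⟩ := hcase
    obtain ⟨e, he, rfl⟩ := hpe hp4
    obtain ⟨y₀, hy₀⟩ : ∃ y, b (aeval (traceOp u) ((X - C e) ^ j * q) (skewOp u v)) y ≠ 0 := by
      by_contra! h
      exact hv (hnd.1 _ h)
    have hxy : b (aeval (traceOp u) ((X - C e) ^ j) (skewOp u (aeval (traceOp u) q
        (aeval (traceOp u) a v)))) (aeval (traceOp u) q y₀) ≠ 0 := by
      rwa [← aeval_traceOp_adjoint hu, ← aeval_traceOp_skewOp_apply, ← aeval_traceOp_skewOp_apply,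
        ← aeval_mul_apply, ← aeval_mul_apply, ← aeval_mul_apply,
        show q * (X - C e) ^ j * q * a = (X - C e) ^ j * q * (a * q) by ring, hreduce]
    -- First x is corrected using the orbit of the second vector, then the second vector using the
    -- orbit of the new x; the pairing stays nonzero throughout.
    obtain ⟨x, hx, hxy, hxx⟩ := exists_isotropic h2 hb hu he (hkill' _) (hkill' _) hxy
    rw [aeval_skewOp_swap hb hu, neg_ne_zero] at hxy
    obtain ⟨y, hy, hyx, hyy⟩ := exists_isotropic h2 hb hu he (hkill' _) hx hxy
    have hxy := hyx
    rw [aeval_skewOp_swap hb hu, neg_ne_zero] at hxy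
    have hiso {x : V} (hx : ∀ f : F[X], b (aeval (traceOp u) f x) x = 0) {z : V}
        (hz : z ∈ orbitSpan u x) : b z x = 0 := by
      obtain ⟨f, g, rfl⟩ := exists_aeval_add_aeval_of_mem_orbitSpan h2 hz
      rw [map_add, LinearMap.add_apply, hx, aeval_traceOp_skewOp_self h2 hb hu, add_zero]
    have hiso' {x : V} (hx : ∀ f : F[X], b (aeval (traceOp u) f x) x = 0) {z w : V}
        (hz : z ∈ orbitSpan u x) (hw : w ∈ orbitSpan u x) : b z w = 0 := by
      obtain ⟨f, g, rfl⟩ := exists_aeval_add_aeval_of_mem_orbitSpan h2 hw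
      have h (f : F[X]) {z : V} (hz : z ∈ orbitSpan u x) : b z (aeval (traceOp u) f x) = 0 := by
        rw [← aeval_traceOp_adjoint hu]
        exact hiso hx (aeval_traceOp_mem_orbitSpan f hz)
      rw [map_add, h f hz, zero_add, aeval_traceOp_skewOp_apply, ← neg_eq_zero, ← skewOp_adjoint hu,
        h g (skewOp_mem_orbitSpan hz)]
    refine ⟨x, y, ?_, fun n => ?_, ?_⟩
    · rintro rfl
      simp at hyx
    · rw [hiso hxx (zpow_mem_orbitSpan u x n), hiso hyy (zpow_mem_orbitSpan u y n)]
    · refine Submodule.disjoint_def.2 fun z hz hz' => ?_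
      obtain ⟨z₁, hz₁, z₂, hz₂, rfl⟩ := Submodule.mem_sup.1 hz
      rw [eq_zero_of_mem_orbitSpan_of_forall_mem h2 hb hu he hx hxy hz₁ fun w hw => ?_,
        eq_zero_of_mem_orbitSpan_of_forall_mem h2 hb hu he hy hyx hz₂ fun w hw => ?_, add_zero]
      · have := hz' w (Submodule.mem_sup_left hw)
        rwa [hb.eq, map_add, LinearMap.add_apply, hiso' hxx hz₁ hw, zero_add] at this
      · have := hz' w (Submodule.mem_sup_right hw)
        rwa [hb.eq, map_add, LinearMap.add_apply, hiso' hyy hz₂ hw, add_zero] at this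
  · obtain ⟨x₀, hx₀⟩ := exists_apply_self_ne_zero h2 hb hnd (aeval_traceOp_adjoint hu _) hc0
    set x := aeval (traceOp u) q x₀ with hxdef
    have hx : aeval (traceOp u) (p ^ (j + 1)) x = 0 := hkill' _
    have hxx : b (aeval (traceOp u) (p ^ j * a) x) x ≠ 0 := by
      rw [hxdef, ← aeval_traceOp_adjoint hu, ← aeval_mul_apply, ← aeval_mul_apply,
        show q * (p ^ j * a) * q = p ^ j * q * (a * q) by ring, hreduce]
      exact hx₀
    have hδx : aeval (traceOp u) (p ^ (j + 1)) (skewOp u x) = 0 := by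
      rw [aeval_traceOp_skewOp_apply, hx, map_zero]
    refine ⟨x, x, ?_, fun n => rfl, ?_⟩
    · intro h
      rw [h] at hxx
      simp at hxx
    rw [sup_idem]
    refine disjoint_orthogonal_orbitSpan h2 hb hu (fun f hf =>
      aeval_apply_eq_zero_of_functional hp hx (LinearMap.flip b x) (g := a) hxx hf) fun f hf => ?_
    -- On F[τ]δx the form is b(f(τ)δx, δx) = -b(f(τ)(τ² - 4)x, x). If p divides X² - 4, the factor X
    -- - e lost there is offset by δx having exponent j instead of j + 1; the cofactor X + e is
    -- coprime to p.
    by_cases hp4 : p ∣ X ^ 2 - 4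
    · have hδ : aeval (traceOp u) (p ^ j) (skewOp u x) = 0 := by
        by_contra h
        refine hcase ⟨hp4, x₀, ?_⟩
        rwa [aeval_mul_apply, aeval_traceOp_skewOp_apply u q]
      obtain ⟨e, he, rfl⟩ := hpe hp4
      rcases j with _ | i
      · rw [pow_zero, map_one, Module.End.one_apply] at hδ
        rw [hδ, map_zero]
      · have hcop : IsCoprime (X + C e) (X - C e) := by
          have he0 : 2 * e ≠ 0 := by
            refine mul_ne_zero h2 fun h => mul_ne_zero h2 h2 ?_
            linear_combination -he + e * h
          refine ⟨C (2 * e)⁻¹, -C (2 * e)⁻¹, ?_⟩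
          rw [show C (2 * e)⁻¹ * (X + C e) + -C (2 * e)⁻¹ * (X - C e) =
            C (2 * e)⁻¹ * (2 * C e) by ring, ← C_ofNat, ← C_mul, ← C_mul, inv_mul_cancel₀ he0, C_1]
        obtain ⟨g, hg⟩ := exists_functional_ne_zero_of_isCoprime hx (LinearMap.flip b x) hxx hcop
        refine aeval_apply_eq_zero_of_functional hp hδ (LinearMap.flip b (skewOp u x)) (g := g) ?_ hf
        rw [LinearMap.flip_apply, aeval_traceOp_skewOp_skewOp hu, neg_ne_zero, sq_sub_four_eq he,
          show (X - C e) ^ i * g * ((X - C e) * (X + C e)) = (X - C e) ^ (i + 1) * g * (X + C e) by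
            ring]
        exact hg
    · obtain ⟨g, hg⟩ := exists_functional_ne_zero_of_isCoprime hx (LinearMap.flip b x) hxx
        (hp.coprime_iff_not_dvd.2 hp4).symm
      refine aeval_apply_eq_zero_of_functional hp hδx (LinearMap.flip b (skewOp u x)) (g := g) ?_ hf
      rw [LinearMap.flip_apply, aeval_traceOp_skewOp_skewOp hu, neg_ne_zero]
      exact hg

end Isometries

-- Induction on the dimension and conclusion

universe w in
/-- An isometry of a nondegenerate symmetric space is reversed by some isometric involution. -/
theorem exists_reversing_involution {F : Type*} [Field F] (h2 : (2 : F) ≠ 0) (d : ℕ) :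
    ∀ (V : Type w) [AddCommGroup V] [Module F V] [FiniteDimensional F V]
      (b : LinearMap.BilinForm F V), Module.finrank F V = d → b.IsSymm → b.Nondegenerate →
      ∀ u ∈ isomGroup b, ∃ s : V →ₗ[F] V, (∀ z, s (s z) = z) ∧ (∀ z, s (u (s (u z))) = z) ∧
        ∀ z w, b (s z) (s w) = b z w := by
  induction d using Nat.strong_induction_on with
  | _ d ih =>
  intro V _ _ _ b hd hs hb u hu
  rcases subsingleton_or_nontrivial V with hV | hV
  · exact ⟨0, fun z => Subsingleton.elim _ _, fun z => Subsingleton.elim _ _,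
      fun z w => by rw [Subsingleton.elim z 0]; simp⟩
  obtain ⟨x, y, hx, hxy, hW⟩ := exists_disjoint_orthogonal_orbitSpan h2 hs hb hu
  obtain ⟨s₁, hs₁⟩ := exists_reversing_on_orbitSpan hs hu hxy hW
  have hWu : ∀ z ∈ orbitSpan u x ⊔ orbitSpan u y, u z ∈ orbitSpan u x ⊔ orbitSpan u y := by
    intro z hz
    obtain ⟨p, hp, q, hq, rfl⟩ := Submodule.mem_sup.1 hz
    rw [map_add]
    exact Submodule.add_mem_sup (apply_mem_orbitSpan hp) (apply_mem_orbitSpan hq)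
  have hxW : x ∈ orbitSpan u x ⊔ orbitSpan u y :=
    Submodule.mem_sup_left (self_mem_orbitSpan u x)
  generalize orbitSpan u x ⊔ orbitSpan u y = W at *
  have hC : IsCompl W (b.orthogonal W) :=
    (LinearMap.BilinForm.isCompl_orthogonal_iff_disjoint hs.isRefl).2 hW
  have hWu' := inv_apply_mem_of_invariant hWu
  have hOu : ∀ z ∈ b.orthogonal W, u z ∈ b.orthogonal W := by
    intro z hz t ht
    have h := hz _ (hWu' t ht)
    rwa [isometry_adjoint_inv hu] at h
  have hOu' : ∀ z ∈ b.orthogonal W, u⁻¹ z ∈ b.orthogonal W := by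
    intro z hz t ht
    have h := hz _ (hWu t ht)
    rwa [isometry_adjoint hu] at h
  let u₂ : b.orthogonal W ≃ₗ[F] b.orthogonal W :=
    LinearEquiv.ofLinearMap ((u : V →ₗ[F] V).restrict hOu)
      ((u⁻¹ : V ≃ₗ[F] V).toLinearMap.restrict hOu')
      (by
        ext z
        exact LinearEquiv.congr_fun (mul_inv_cancel u) z)
      (by
        ext z
        exact LinearEquiv.congr_fun (inv_mul_cancel u) z)
  have hu₂ (z : b.orthogonal W) : (u₂ z : V) = u z := rfl
  have hcard : Module.finrank F (b.orthogonal W) < d := by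
    rw [← hd]
    refine Submodule.finrank_lt fun h => hx ?_
    exact Submodule.disjoint_def.1 hW x hxW (h ▸ Submodule.mem_top)
  obtain ⟨s₂, h₂, h₂', h₂''⟩ := ih _ hcard (b.orthogonal W) (b.restrict (b.orthogonal W)) rfl
    ⟨fun z w => hs.eq z w⟩
    ((LinearMap.BilinForm.restrict_nondegenerate_iff_isCompl_orthogonal hs.isRefl).2 (by
      rw [LinearMap.BilinForm.orthogonal_orthogonal hb hs.isRefl]
      exact hC.symm)) u₂ (fun z w => hu z w)
  let P := W.projectionOnto _ hC
  let Q := (b.orthogonal W).projectionOnto _ hC.symm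
  -- `s₁` is controlled only on W, so it is precomposed with the projection onto W and glued to `s₂`
  -- on the complement.
  let s : V →ₗ[F] V := s₁ ∘ₗ W.subtype ∘ₗ P + (b.orthogonal W).subtype ∘ₗ s₂ ∘ₗ Q
  have hsW (p : V) (hp : p ∈ W) (q : b.orthogonal W) : s (p + q) = s₁ p + s₂ q := by
    simp [s, P, Q, Submodule.projectionOnto_apply_of_mem_left hC hp,
      Submodule.projectionOnto_apply_eq_zero_iff hC.symm |>.2 hp]
  have hdec (z : V) : ∃ p ∈ W, ∃ q : b.orthogonal W, z = p + q := by
    obtain ⟨p, hp, q, hq, rfl⟩ := Submodule.mem_sup.1 (hC.sup_eq_top ▸ Submodule.mem_top (x := z))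
    exact ⟨p, hp, ⟨q, hq⟩, rfl⟩
  have hort (p : V) (hp : p ∈ W) (q : b.orthogonal W) : b p q = 0 := q.2 p hp
  have hort' (p : V) (hp : p ∈ W) (q : b.orthogonal W) : b q p = 0 := by rw [hs.eq, hort p hp]
  refine ⟨s, fun z => ?_, fun z => ?_, fun z w => ?_⟩
  · obtain ⟨p, hp, q, rfl⟩ := hdec z
    rw [hsW p hp, hsW _ (hs₁ p hp).1, (hs₁ p hp).2.1, h₂]
  · obtain ⟨p, hp, q, rfl⟩ := hdec z
    have hup := hWu p hp
    rw [map_add, ← hu₂, hsW _ hup, map_add, ← hu₂, hsW _ (hWu _ (hs₁ _ hup).1),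
      (hs₁ p hp).2.2.1, h₂']
  · obtain ⟨p, hp, q, rfl⟩ := hdec z
    obtain ⟨p', hp', q', rfl⟩ := hdec w
    have h := h₂'' q q'
    simp only [LinearMap.BilinForm.restrict_apply, LinearMap.domRestrict_apply] at h
    rw [hsW p hp, hsW p' hp']
    simp only [map_add, LinearMap.add_apply]
    rw [hort _ (hs₁ p hp).1, hort' _ (hs₁ p' hp').1, hort _ hp, hort' _ hp',
      (hs₁ p hp).2.2.2 p' hp', h]

theorem theorem1p6 {F V : Type*} [Field F] (hF : ringChar F ≠ 2)
    [AddCommGroup V] [Module F V] [FiniteDimensional F V]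
    (b : LinearMap.BilinForm F V) (hsymm : b.IsSymm) (hb : b.Nondegenerate)
    (u : isomGroup b) : IsBireflectional u := by
  obtain ⟨s, hs, hsu, hsb⟩ :=
    exists_reversing_involution (Ring.two_ne_zero hF) _ V b rfl hsymm hb u u.2
  let t : isomGroup b := ⟨LinearEquiv.ofInvolutive s hs, hsb⟩
  have ht : t * t = 1 := Subtype.ext (LinearEquiv.ext hs)
  refine ⟨t, t * u, ?_, ?_, ?_⟩
  · rw [IsGroupInvolution, pow_two, ht]
  · rw [IsGroupInvolution, pow_two]
    exact Subtype.ext (LinearEquiv.ext hsu)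
  · rw [← mul_assoc, ht, one_mul]
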